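/- For a finite generating set $S$ of a group $G$, let $\ell_{G,S}(g)$ be the minimal length of a product of elements of $S\cup S^{-1}$ equal to $g$, let $F_{G,S}(n)=\#\{g\in G : \ell_{G,S}(g)\le n\}$, and let $\omega(G,S)=\lim_{n\to\infty}F_{G,S}(n)^{1/n}$ be the exponential growth rate of $G$ with respect to $S$. For a finitely generated group $G$ let $\Omega(G)=\inf_S\omega(G,S)$, where $S$ runs over all finite generating sets of $G$. An HNN extension $H*_\theta$ relative to an isomorphism $\theta:A\to B$ between subgroups of $H$ is called non-semidirect if at least one of $A$, $B$ is a proper subgroup of $H$. Let $\mathcal L_2=(\mathbb Z/2\mathbb Z)\wr\mathbb Z=\bigl(\bigoplus_{\mathbb Z}\mathbb Z/2\mathbb Z\bigr)\rtimes\mathbb Z$ be the lamplighter group (restricted wreath product), where $\mathbb Z$ acts by translation of coordinates, let $a$ be the generator of the copy of $\mathbb Z/2\mathbb Z$ at position $0$, and let $t$ be the generator $1$ of $\mathbb Z$. Then $\{a,t\}$ generates $\mathcal L_2$, the minimal growth rate of $\mathcal L_2$ is attained on $\{a,t\}$, and it equals the golden ratio: $$\Omega(\mathcal L_2)=\omega(\mathcal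 L_2,\{a,t\})=\frac{1+\sqrt5}{2}.$$ Moreover, $\mathcal L_2$ is isomorphic to a non-semidirect HNN extension. Consequently the constant $\frac{1+\sqrt5}{2}$ in Mann's lower bound $\Omega(G)\ge\frac{1+\sqrt5}{2}$ for finitely generated non-semidirect HNN extensions $G$ is optimal: if a real number $c$ satisfies $c\le\Omega(G)$ for every finitely generated non-semidirect HNN extension $G$, then $c\le\frac{1+\sqrt5}{2}$. -/

import Mathlib

open Filter Topology

section Growth

variable {G : Type*} [Group G]

/-- The length of `g` with respect to `S`: the minimal length of a product of elements of
`S ∪ S⁻¹` that equals `g` (it is `⊤` if there is no such product). -/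
noncomputable def wordLength (S : Set G) (g : G) : ℕ∞ :=
  ⨅ l : {l : List G // (∀ x ∈ l, x ∈ S ∨ x⁻¹ ∈ S) ∧ l.prod = g}, (l.1.length : ℕ∞)

/-- The growth function: the number of elements in the ball of radius `n` around the identity. -/
noncomputable def growthFunction (S : Set G) (n : ℕ) : ℕ :=
  Nat.card {g : G // wordLength S g ≤ n}

/-- The exponential growth rate `ω(G, S) = lim F(n)^(1/n)`; the limit exists for every finite `S`,
see `tendsto_growthRate`. -/
noncomputable def growthRate (S : Set G) : ℝ :=
  limUnder atTop fun n : ℕ => (growthFunction S n : ℝ) ^ (1 / (n : ℝ))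

/-- The minimal growth rate `Ω(G)`: the infimum of `ω(G, S)` over all finite generating sets. -/
noncomputable def minimalGrowthRate (G : Type*) [Group G] : ℝ :=
  sInf {r : ℝ | ∃ S : Set G, S.Finite ∧ Subgroup.closure S = ⊤ ∧ growthRate S = r}

theorem wordLength_le_iff (S : Set G) (g : G) (n : ℕ) :
    wordLength S g ≤ n ↔
      ∃ l : List G, (∀ x ∈ l, x ∈ S ∨ x⁻¹ ∈ S) ∧ l.prod = g ∧ l.length ≤ n := by
  constructor
  · intro h
    have h' : wordLength S g < ((n + 1 : ℕ) : ℕ∞) :=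
      lt_of_le_of_lt h (by exact_mod_cast Nat.lt_succ_self n)
    obtain ⟨⟨l, hl, hg⟩, hlt⟩ := iInf_lt_iff.1 h'
    exact ⟨l, hl, hg, Nat.lt_succ_iff.1 (by exact_mod_cast hlt)⟩
  · rintro ⟨l, hl, hg, hn⟩
    exact (iInf_le _ (⟨l, hl, hg⟩ : {l : List G // (∀ x ∈ l, x ∈ S ∨ x⁻¹ ∈ S) ∧ l.prod = g})).trans
      (by exact_mod_cast hn)

theorem finite_ball {S : Set G} (hS : S.Finite) (n : ℕ) :
    Finite {g : G // wordLength S g ≤ n} := by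
  have hT : (S ∪ S⁻¹).Finite := hS.union hS.inv
  have : Finite ↥(S ∪ S⁻¹) := hT
  have hfin := List.finite_length_le (↥(S ∪ S⁻¹)) n
  refine ((hfin.image fun l => (l.map Subtype.val).prod).subset ?_ :
    Set.Finite {g | wordLength S g ≤ n})
  intro g hg
  obtain ⟨l, hl, hp, hn⟩ := (wordLength_le_iff S g n).1 hg
  refine ⟨l.attach.map fun x => ⟨x.1, hl x.1 x.2⟩, ?_, ?_⟩
  · simpa using hn
  · simpa [List.map_map, Function.comp_def] using hp

theorem growthFunction_pos {S : Set G} (hS : S.Finite) (n : ℕ) : 0 < growthFunction S n := by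
  have := finite_ball hS n
  have : Nonempty {g : G // wordLength S g ≤ n} :=
    ⟨1, (wordLength_le_iff S 1 n).2 ⟨[], by simp⟩⟩
  exact Nat.card_pos

theorem growthFunction_add_le {S : Set G} (hS : S.Finite) (m n : ℕ) :
    growthFunction S (m + n) ≤ growthFunction S m * growthFunction S n := by
  have := finite_ball hS m
  have := finite_ball hS n
  unfold growthFunction
  rw [← Nat.card_prod]
  have key : ∀ g : {g : G // wordLength S g ≤ (m + n : ℕ)},
      ∃ p : {g : G // wordLength S g ≤ m} × {g : G // wordLength S g ≤ n},
        p.1.1 * p.2.1 = g.1 := by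
    rintro ⟨g, hg⟩
    obtain ⟨l, hl, hp, hn⟩ := (wordLength_le_iff S g _).1 hg
    refine ⟨⟨⟨(l.take m).prod, (wordLength_le_iff S _ m).2
      ⟨_, fun x hx => hl x (List.mem_of_mem_take hx), rfl, by simp⟩⟩,
      ⟨(l.drop m).prod, (wordLength_le_iff S _ n).2
      ⟨_, fun x hx => hl x (List.mem_of_mem_drop hx), rfl, by simp; omega⟩⟩⟩, ?_⟩
    simpa [← List.prod_append] using hp
  choose f hf using key
  refine Nat.card_le_card_of_injective f fun x y hxy => Subtype.ext ?_
  rw [← hf x, ← hf y, hxy]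

/-- The limit in the definition of the exponential growth rate exists. -/
theorem tendsto_growthRate {S : Set G} (hS : S.Finite) :
    Tendsto (fun n : ℕ => (growthFunction S n : ℝ) ^ (1 / (n : ℝ))) atTop (𝓝 (growthRate S)) := by
  have hpos : ∀ n, (0 : ℝ) < growthFunction S n := fun n => by
    exact_mod_cast growthFunction_pos hS n
  have hsub : Subadditive fun n => Real.log (growthFunction S n) := fun m n => by
    rw [← Real.log_mul (hpos m).ne' (hpos n).ne']
    exact Real.log_le_log (hpos _) (by exact_mod_cast growthFunction_add_le hS m n)
  have hlim := hsub.tendsto_lim ⟨0, by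
    rintro _ ⟨n, rfl⟩
    refine div_nonneg (Real.log_nonneg ?_) (Nat.cast_nonneg n)
    exact_mod_cast growthFunction_pos hS n⟩
  refine tendsto_nhds_limUnder ⟨Real.exp hsub.lim, ?_⟩
  refine ((Real.continuous_exp.tendsto _).comp hlim).congr fun n => ?_
  rw [Function.comp_apply, Real.rpow_def_of_pos (hpos n), mul_one_div]

end Growth

section HNN

universe u

/-- `G` is a non-semidirect HNN extension: it is isomorphic to an HNN extension of a group `H`
relative to an isomorphism `θ : A ≃* B` of subgroups of `H`, at least one of which is proper. -/
def IsNonSemidirectHNN (G : Type u) [Group G] : Prop :=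
  ∃ (H : Type u) (_ : Group H) (A B : Subgroup H) (θ : A ≃* B),
    (A ≠ ⊤ ∨ B ≠ ⊤) ∧ Nonempty (G ≃* HNNExtension H A B θ)

end HNN

namespace Lamplighter

/-- The action of `ℤ` on finitely supported lamp configurations by translation:
`(shift k f) i = f (i - k)`. -/
noncomputable def shift (n : ℕ) : Multiplicative ℤ →* MulAut (Multiplicative (ℤ →₀ ZMod n)) where
  toFun k := AddEquiv.toMultiplicative (Finsupp.domCongr (Equiv.addLeft k.toAdd))
  map_one' := by
    ext f : 1
    apply Multiplicative.toAdd.injective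
    ext i
    simp [Finsupp.domCongr_apply, Finsupp.equivMapDomain_apply]
    rfl
  map_mul' k l := by
    ext f : 1
    apply Multiplicative.toAdd.injective
    ext i
    simp [Finsupp.domCongr_apply, Finsupp.equivMapDomain_apply]
    rfl

end Lamplighter

/-- The lamplighter group: the restricted wreath product `(ℤ/nℤ) ≀ ℤ`. -/
abbrev Lamplighter (n : ℕ) : Type :=
  Multiplicative (ℤ →₀ ZMod n) ⋊[Lamplighter.shift n] Multiplicative ℤ

namespace Lamplighter

/-- The canonical generator `a`: the generator of the copy of `ℤ/nℤ` at position `0`. -/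
noncomputable def a (n : ℕ) : Lamplighter n :=
  SemidirectProduct.inl (Multiplicative.ofAdd (Finsupp.single 0 1))

/-- The canonical generator `t`: the generator of `ℤ`. -/
noncomputable def t (n : ℕ) : Lamplighter n :=
  SemidirectProduct.inr (Multiplicative.ofAdd 1)

end Lamplighter

/-! Lower bound: any generating set contains a non-commuting pair. The lamp configurations form an
abelian group, so one of the two moves the lamplighter; after inverting, it moves right. If the
other does not move, multiply it by the first. This gives non-commuting right-moving elements of
lengths at most 1 and 2. They generate a free monoid (`mul_ne_mul_of_not_commute`), so balls contain
Fibonacci-many elements (`goldenRatio_le_growthRate`).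

Upper bound: a word in `a`, `t` of length m sweeps an interval and pays one letter per step and one
per lit lamp (`exists_interval_of_word`). Weighting subsets of an interval by powers of `φ⁻¹` and
using `φ⁻¹ + φ⁻² = 1` bounds the count by `φ ^ (m + 1)` up to a polynomial factor
(`card_filter_powerset_le`).

HNN structure: conjugation by `t` maps the lamps at nonnegative positions properly into themselves,
so the group is an ascending HNN extension (`isNonSemidirectHNN_of_ascending`). -/

namespace Lamplighter

/-! ### Coordinates on the lamplighter group; free submonoids -/

variable {n : ℕ}

/-- The lamp configuration of an element of the lamplighter group. -/
def lamp (g : Lamplighter n) : ℤ →₀ ZMod n := g.left.toAdd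

/-- The position of the lamplighter. -/
def pos (g : Lamplighter n) : ℤ := g.right.toAdd

theorem toAdd_shift_apply (k : Multiplicative ℤ) (f : Multiplicative (ℤ →₀ ZMod n)) (i : ℤ) :
    (shift n k f).toAdd i = f.toAdd (i - k.toAdd) := by
  change (Finsupp.domCongr (Equiv.addLeft k.toAdd) f.toAdd) i = _
  simp [Finsupp.domCongr_apply, Finsupp.equivMapDomain_apply, sub_eq_neg_add]

theorem ext_lamp_pos {g h : Lamplighter n} (hl : ∀ i, lamp g i = lamp h i) (hp : pos g = pos h) :
    g = h := by
  refine SemidirectProduct.ext (Multiplicative.toAdd.injective (Finsupp.ext hl))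
    (Multiplicative.toAdd.injective hp)

@[simp] theorem lamp_one : lamp (1 : Lamplighter n) = 0 := rfl

@[simp] theorem pos_one : pos (1 : Lamplighter n) = 0 := rfl

@[simp] theorem pos_mul (g h : Lamplighter n) : pos (g * h) = pos g + pos h := rfl

@[simp] theorem pos_inv (g : Lamplighter n) : pos g⁻¹ = -pos g := rfl

@[simp] theorem lamp_mul_apply (g h : Lamplighter n) (i : ℤ) :
    lamp (g * h) i = lamp g i + lamp h (i - pos g) := by
  change lamp g i + (shift n g.right h.left).toAdd i = _
  rw [toAdd_shift_apply]
  rfl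

@[simp] theorem lamp_inv_apply (g : Lamplighter n) (i : ℤ) :
    lamp g⁻¹ i = -lamp g (i + pos g) := by
  have h := lamp_mul_apply g g⁻¹ (i + pos g)
  rw [mul_inv_cancel, add_sub_cancel_right] at h
  simp only [lamp_one, Finsupp.coe_zero, Pi.zero_apply] at h
  exact eq_neg_of_add_eq_zero_right h.symm

@[simp] theorem lamp_a : lamp (a n) = Finsupp.single 0 1 := rfl

@[simp] theorem pos_a : pos (a n) = 0 := rfl

@[simp] theorem lamp_t : lamp (t n) = 0 := rfl

@[simp] theorem pos_t : pos (t n) = 1 := rfl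

@[simp] theorem pos_zpow (g : Lamplighter n) (k : ℤ) : pos (g ^ k) = k * pos g := by
  have h : (g ^ k).right = g.right ^ k :=
    map_zpow (SemidirectProduct.rightHom (φ := shift n)) g k
  simp [pos, h]

@[simp] theorem lamp_t_zpow (k : ℤ) : lamp (t n ^ k) = 0 := by
  have h : t n ^ k = SemidirectProduct.inr (Multiplicative.ofAdd (1 : ℤ) ^ k) := by
    rw [map_zpow]; rfl
  rw [h]; rfl

theorem t_zpow_mul_a_mul (i : ℤ) :
    t n ^ i * a n * t n ^ (-i) =
      SemidirectProduct.inl (Multiplicative.ofAdd (Finsupp.single i 1)) := by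
  refine ext_lamp_pos (fun j => ?_) ?_
  · have : lamp (SemidirectProduct.inl (Multiplicative.ofAdd (Finsupp.single i 1)) :
      Lamplighter n) = Finsupp.single i 1 := rfl
    simp only [lamp_mul_apply, lamp_t_zpow, this, lamp_a, pos_zpow, pos_t, Finsupp.coe_zero,
      Pi.zero_apply, zero_add, add_zero, mul_one, Finsupp.single_apply]
    simp only [eq_comm (a := (0 : ℤ)), sub_eq_zero, eq_comm (a := j)]
  · have : pos (SemidirectProduct.inl (Multiplicative.ofAdd (Finsupp.single i 1)) :
      Lamplighter n) = 0 := rfl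
    simp [this]

theorem eq_inl_mul_t_zpow (g : Lamplighter n) :
    g = SemidirectProduct.inl g.left * t n ^ pos g := by
  refine ext_lamp_pos (fun j => ?_) ?_
  · have : lamp (SemidirectProduct.inl g.left : Lamplighter n) = lamp g := rfl
    simp [this]
  · have : pos (SemidirectProduct.inl g.left : Lamplighter n) = 0 := rfl
    simp [this]

theorem closure_a_t : Subgroup.closure {a n, t n} = ⊤ := by
  have ha : a n ∈ Subgroup.closure {a n, t n} := Subgroup.subset_closure (by simp)
  have ht : t n ∈ Subgroup.closure {a n, t n} := Subgroup.subset_closure (by simp)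
  have hinl : ∀ f : ℤ →₀ ZMod n, (SemidirectProduct.inl (Multiplicative.ofAdd f) : Lamplighter n) ∈
      Subgroup.closure {a n, t n} := by
    intro f
    induction f using Finsupp.induction_linear with
    | zero => exact one_mem _
    | add f g hf hg =>
      rw [ofAdd_add, map_mul]
      exact mul_mem hf hg
    | single i c =>
      obtain ⟨m, rfl⟩ := ZMod.intCast_surjective c
      have : Finsupp.single i (m : ZMod n) = m • Finsupp.single i (1 : ZMod n) := by
        simp
      rw [this, ofAdd_zsmul, map_zpow, ← t_zpow_mul_a_mul]
      exact zpow_mem (mul_mem (mul_mem (zpow_mem ht _) ha) (zpow_mem ht _)) _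
  refine eq_top_iff.2 fun g _ => ?_
  rw [eq_inl_mul_t_zpow g]
  exact mul_mem (hinl _) (zpow_mem ht _)

/-- Two non-commuting elements which both move the lamplighter to the right generate a free
monoid. -/
theorem mul_ne_mul_of_not_commute {x y : Lamplighter n} (hx : 0 < pos x) (hy : 0 < pos y)
    (hxy : ¬Commute x y) {u v : Lamplighter n} (hu : u ∈ Submonoid.closure {x, y})
    (hv : v ∈ Submonoid.closure {x, y}) : x * u ≠ y * v := by
  -- `D` measures the failure to commute with `x`, and is a cocycle for the translation action. As
  -- `D x = 0` and `D y ≠ 0`, the lowest position `e` in the support of `D y` separates the two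
  -- products: `D` vanishes there on `x * u` but not on `y * v`.
  set D : Lamplighter n → ℤ →₀ ZMod n := fun u => lamp (u * x) - lamp (x * u) with hD
  have Dmul : ∀ u v i, D (u * v) i = D u i + D v (i - pos u) := by
    intro u v i
    simp only [hD, Finsupp.sub_apply, lamp_mul_apply, pos_mul, sub_sub,
      add_comm (pos x) (pos u)]
    ring
  have Dx : D x = 0 := sub_self _
  have Dy : D y ≠ 0 := by
    intro h
    refine hxy (ext_lamp_pos (fun i => ?_) (add_comm _ _))
    exact (DFunLike.congr_fun (sub_eq_zero.1 h) i).symm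
  have hne : (D y).support.Nonempty := Finsupp.support_nonempty_iff.2 Dy
  set e := (D y).support.min' hne
  have he : D y e ≠ 0 := Finsupp.mem_support_iff.1 (Finset.min'_mem _ hne)
  have hlt : ∀ i < e, D y i = 0 := fun i hi => by
    by_contra h
    exact absurd (Finset.min'_le _ i (Finsupp.mem_support_iff.2 h)) (not_le.2 hi)
  have key : ∀ w ∈ Submonoid.closure {x, y}, 0 ≤ pos w ∧ ∀ i < e, D w i = 0 := by
    intro w hw
    induction hw using Submonoid.closure_induction with
    | mem w hw =>
      rcases hw with rfl | rfl
      · exact ⟨hx.le, fun i _ => by rw [Dx]; rfl⟩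
      · exact ⟨hy.le, hlt⟩
    | one => exact ⟨le_rfl, fun i _ => by simp [hD]⟩
    | mul u v _ _ hu hv =>
      refine ⟨add_nonneg hu.1 hv.1, fun i hi => ?_⟩
      rw [Dmul, hu.2 i hi, hv.2 _ (by linarith [hu.1]), add_zero]
  intro h
  have h1 := Dmul x u e
  rw [h, Dmul, (key u hu).2 _ (by linarith), (key v hv).2 _ (by linarith), Dx] at h1
  exact he (by simpa using h1)

end Lamplighter

/-! ### Growth estimates and the golden ratio -/

section GoldenRatio

open scoped goldenRatio

section GrowthBounds

variable {G : Type*} [Group G]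

theorem tendsto_const_rpow_one_div {c : ℝ} (hc : 0 < c) :
    Tendsto (fun n : ℕ => c ^ (1 / (n : ℝ))) atTop (𝓝 1) := by
  simpa using (tendsto_const_nhds (x := c)).rpow tendsto_one_div_atTop_nhds_zero_nat
    (Or.inl hc.ne')

/-- An exponential lower bound for the growth function bounds the growth rate. -/
theorem le_growthRate_of_le {S : Set G} (hS : S.Finite) {c r : ℝ} (hc : 0 < c) (hr : 0 < r)
    (h : ∀ n, c * r ^ n ≤ growthFunction S n) : r ≤ growthRate S := by
  have hlim : Tendsto (fun n : ℕ => c ^ (1 / (n : ℝ)) * r) atTop (𝓝 r) := by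
    simpa using (tendsto_const_rpow_one_div hc).mul_const r
  refine le_of_tendsto_of_tendsto hlim (tendsto_growthRate hS) ?_
  filter_upwards [eventually_ne_atTop 0] with n hn
  calc c ^ (1 / (n : ℝ)) * r = (c * r ^ n) ^ (1 / (n : ℝ)) := by
        rw [Real.mul_rpow hc.le (by positivity), one_div, Real.pow_rpow_inv_natCast hr.le hn]
    _ ≤ _ := Real.rpow_le_rpow (by positivity) (h n) (by positivity)

/-- An exponential upper bound for the growth function, up to a polynomial factor, bounds the
growth rate. -/
theorem growthRate_le_of_le {S : Set G} (hS : S.Finite) {c r : ℝ} (d : ℕ) (hc : 0 < c)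
    (hr : 0 < r) (h : ∀ n : ℕ, n ≠ 0 → (growthFunction S n : ℝ) ≤ c * (n : ℝ) ^ d * r ^ n) :
    growthRate S ≤ r := by
  have hn1 : Tendsto (fun n : ℕ => (n : ℝ) ^ (1 / (n : ℝ))) atTop (𝓝 1) :=
    tendsto_rpow_div.comp tendsto_natCast_atTop_atTop
  have hlim : Tendsto (fun n : ℕ => c ^ (1 / (n : ℝ)) * ((n : ℝ) ^ (1 / (n : ℝ))) ^ d * r) atTop
      (𝓝 r) := by
    simpa using ((tendsto_const_rpow_one_div hc).mul (hn1.pow d)).mul_const r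
  refine le_of_tendsto_of_tendsto (tendsto_growthRate hS) hlim ?_
  filter_upwards [eventually_ne_atTop 0] with n hn
  calc (growthFunction S n : ℝ) ^ (1 / (n : ℝ))
      ≤ (c * (n : ℝ) ^ d * r ^ n) ^ (1 / (n : ℝ)) :=
        Real.rpow_le_rpow (by positivity) (h n hn) (by positivity)
    _ = _ := by
        rw [Real.mul_rpow (by positivity) (by positivity), Real.mul_rpow hc.le (by positivity),
          ← Real.rpow_natCast _ d, ← Real.rpow_natCast _ d, ← Real.rpow_mul (by positivity),
          ← Real.rpow_mul (by positivity), mul_comm (d : ℝ), one_div,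
          Real.pow_rpow_inv_natCast hr.le hn]

theorem wordLength_one_le (S : Set G) (n : ℕ) : wordLength S 1 ≤ n :=
  (wordLength_le_iff S 1 n).2 ⟨[], by simp⟩

theorem wordLength_mul_le {S : Set G} {g h : G} {m n : ℕ} (hg : wordLength S g ≤ m)
    (hh : wordLength S h ≤ n) : wordLength S (g * h) ≤ (m + n : ℕ) := by
  obtain ⟨l, hl, rfl, hm⟩ := (wordLength_le_iff S g m).1 hg
  obtain ⟨l', hl', rfl, hn⟩ := (wordLength_le_iff S h n).1 hh
  refine (wordLength_le_iff S _ _).2 ⟨l ++ l', ?_, List.prod_append, ?_⟩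
  · intro x hx
    rcases List.mem_append.1 hx with h | h
    exacts [hl x h, hl' x h]
  · rw [List.length_append]
    omega

theorem wordLength_le_one_of_mem {S : Set G} {g : G} (hg : g ∈ S ∨ g⁻¹ ∈ S) :
    wordLength S g ≤ (1 : ℕ) :=
  (wordLength_le_iff S g 1).2 ⟨[g], by simpa using hg, by simp, by simp⟩

theorem goldenRatio_pow_le_fib (n : ℕ) : φ⁻¹ * φ ^ n ≤ Nat.fib (n + 1) := by
  have h0 := Real.goldenRatio_pos
  induction n using Nat.twoStepInduction with
  | zero => simpa using inv_le_one_of_one_le₀ Real.one_lt_goldenRatio.le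
  | one => rw [pow_one, inv_mul_cancel₀ h0.ne']; simp
  | more n h1 h2 =>
    rw [Nat.fib_add_two (n := n + 1)]
    push_cast
    have : φ⁻¹ * φ ^ (n + 2) = φ⁻¹ * φ ^ n + φ⁻¹ * φ ^ (n + 1) := by
      rw [← Real.goldenRatio_pow_sub_goldenRatio_pow n]
      ring
    linarith

/-- If `x` has length at most `1`, `y` has length at most `2`, and `x` and `y` generate a free
monoid, then the growth rate is at least the golden ratio. -/
theorem goldenRatio_le_growthRate {S : Set G} (hS : S.Finite) {x y : G}
    (hx : wordLength S x ≤ (1 : ℕ)) (hy : wordLength S y ≤ (2 : ℕ))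
    (hfree : ∀ u ∈ Submonoid.closure {x, y}, ∀ v ∈ Submonoid.closure {x, y}, x * u ≠ y * v) :
    φ ≤ growthRate S := by
  classical
  have hxm : x ∈ Submonoid.closure {x, y} := Submonoid.subset_closure (by simp)
  have hym : y ∈ Submonoid.closure {x, y} := Submonoid.subset_closure (by simp)
  -- Splitting by first letter gives the Fibonacci recursion: freeness makes the translates by `x`
  -- (cost 1) and by `y` (cost 2) disjoint.
  have key : ∀ n : ℕ, ∃ A : Finset G, A.card = Nat.fib (n + 1) ∧
      ∀ g ∈ A, g ∈ Submonoid.closure {x, y} ∧ wordLength S g ≤ n := by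
    intro n
    induction n using Nat.twoStepInduction with
    | zero =>
      refine ⟨{1}, by simp, fun g hg => ?_⟩
      rw [Finset.mem_singleton.1 hg]
      exact ⟨one_mem _, wordLength_one_le S 0⟩
    | one =>
      refine ⟨{x}, by simp, fun g hg => ?_⟩
      rw [Finset.mem_singleton.1 hg]
      exact ⟨hxm, hx⟩
    | more n h1 h2 =>
      obtain ⟨A, hA, hA'⟩ := h1
      obtain ⟨B, hB, hB'⟩ := h2
      refine ⟨B.image (x * ·) ∪ A.image (y * ·), ?_, fun g hg => ?_⟩
      · rw [Finset.card_union_of_disjoint, Finset.card_image_of_injective _ (mul_right_injective x),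
          Finset.card_image_of_injective _ (mul_right_injective y), hA, hB,
          Nat.fib_add_two (n := n + 1), add_comm]
        refine Finset.disjoint_left.2 fun g hg hg' => ?_
        obtain ⟨u, hu, rfl⟩ := Finset.mem_image.1 hg
        obtain ⟨v, hv, h⟩ := Finset.mem_image.1 hg'
        exact hfree u (hB' u hu).1 v (hA' v hv).1 h.symm
      · rcases Finset.mem_union.1 hg with hg | hg
        · obtain ⟨u, hu, rfl⟩ := Finset.mem_image.1 hg
          refine ⟨mul_mem hxm (hB' u hu).1, ?_⟩
          have := wordLength_mul_le hx (hB' u hu).2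
          rwa [show 1 + (n + 1) = n + 2 by omega] at this
        · obtain ⟨u, hu, rfl⟩ := Finset.mem_image.1 hg
          refine ⟨mul_mem hym (hA' u hu).1, ?_⟩
          have := wordLength_mul_le hy (hA' u hu).2
          rwa [show 2 + n = n + 2 by omega] at this
  refine le_growthRate_of_le hS (inv_pos.2 Real.goldenRatio_pos) Real.goldenRatio_pos fun n => ?_
  refine (goldenRatio_pow_le_fib n).trans ?_
  obtain ⟨A, hA, hA'⟩ := key n
  have := finite_ball hS n
  rw [← hA, Nat.cast_le, ← Nat.card_eq_finsetCard]
  exact Nat.card_le_card_of_injective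
    (fun g : A => (⟨g.1, (hA' g.1 g.2).2⟩ : {g : G // wordLength S g ≤ n}))
    fun g h hgh => Subtype.ext (by simpa using hgh)

theorem exists_not_commute_of_closure_eq_top {S : Set G} (hS : Subgroup.closure S = ⊤) {g h : G}
    (hgh : ¬Commute g h) : ∃ x ∈ S, ∃ y ∈ S, ¬Commute x y := by
  by_contra! H
  have h1 : Subgroup.closure S ≤ Subgroup.centralizer S :=
    (Subgroup.closure_le _).2 fun x hx =>
      Subgroup.mem_centralizer_iff.2 fun y hy => H y hy x hx
  have h2 : Subgroup.closure S ≤ Subgroup.centralizer (Subgroup.closure S : Set G) :=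
    (Subgroup.closure_le _).2 fun x hx => Subgroup.mem_centralizer_iff.2 fun y hy =>
      ((Subgroup.mem_centralizer_iff.1 (h1 hy)) x hx).symm
  rw [hS] at h2
  exact hgh (Subgroup.mem_centralizer_iff.1 (h2 (Subgroup.mem_top h)) g (Subgroup.mem_top g))

end GrowthBounds

/-! ### Lower bound for every generating set -/

namespace Lamplighter

variable {n : ℕ}

theorem commute_of_pos_eq_zero {g h : Lamplighter n} (hg : pos g = 0) (hh : pos h = 0) :
    Commute g h :=
  ext_lamp_pos (fun i => by simp [hg, hh, add_comm]) (add_comm _ _)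

theorem not_commute_a_t [Fact (1 < n)] : ¬Commute (a n) (t n) := by
  intro h
  simpa [Finsupp.single_apply] using DFunLike.congr_fun (congrArg lamp h.eq) (0 : ℤ)

theorem goldenRatio_le_growthRate [Fact (1 < n)] {S : Set (Lamplighter n)} (hS : S.Finite)
    (hgen : Subgroup.closure S = ⊤) : φ ≤ growthRate S := by
  obtain ⟨x, hx, y, hy, hxy⟩ := exists_not_commute_of_closure_eq_top hgen (not_commute_a_t (n := n))
  wlog hx0 : pos x ≠ 0 generalizing x y
  · refine this y hy x hx (fun h => hxy h.symm) fun hy0 => hxy ?_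
    exact commute_of_pos_eq_zero (not_not.1 hx0) hy0
  have hpos : ∀ g ∈ S, pos g ≠ 0 → ∃ g', (g' ∈ S ∨ g'⁻¹ ∈ S) ∧ 0 < pos g' ∧
      ∀ h, Commute g' h → Commute g h := by
    intro g hg hg0
    rcases lt_or_gt_of_ne hg0 with h0 | h0
    · exact ⟨g⁻¹, Or.inr (by simpa using hg), by simpa using h0, fun h hh => by
        simpa using hh.inv_left⟩
    · exact ⟨g, Or.inl hg, h0, fun h hh => hh⟩
  obtain ⟨x', hx', hx'0, hcx⟩ := hpos x hx hx0
  have hx'y : ¬Commute x' y := fun h => hxy (hcx y h)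
  by_cases hy0 : pos y = 0
  -- `y` itself stays put, so `x' * y` replaces it at the price of length 2; this is the case that
  -- makes the bound `φ` rather than 2.
  · refine _root_.goldenRatio_le_growthRate hS (y := x' * y) (wordLength_le_one_of_mem hx')
      (wordLength_mul_le (wordLength_le_one_of_mem hx') (wordLength_le_one_of_mem (Or.inl hy)))
      fun u hu v hv => mul_ne_mul_of_not_commute hx'0 (by simpa [hy0] using hx'0) ?_ hu hv
    intro h
    exact hx'y (by simpa using (Commute.refl x').inv_right.mul_right h)
  · obtain ⟨y', hy', hy'0, hcy⟩ := hpos y hy hy0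
    refine _root_.goldenRatio_le_growthRate hS (wordLength_le_one_of_mem hx')
      ((wordLength_le_one_of_mem hy').trans (by norm_num))
      fun u hu v hv => mul_ne_mul_of_not_commute hx'0 hy'0 ?_ hu hv
    exact fun h => hx'y (hcy x' h.symm).symm

end Lamplighter

/-- The number of subsets `t` of a finite set `s` with `#s + #t ≤ m` is at most `φ ^ m`. -/
theorem card_filter_powerset_le {α : Type*} (s : Finset α) (m : ℕ) :
    ((s.powerset.filter fun t => s.card + t.card ≤ m).card : ℝ) ≤ φ ^ m := by
  have h0 := Real.goldenRatio_pos
  have hz : φ⁻¹ * (φ⁻¹ + 1) = 1 := by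
    have h1 : φ * φ⁻¹ = 1 := mul_inv_cancel₀ h0.ne'
    linear_combination (-φ⁻¹ ^ 2) * Real.goldenRatio_sq + (φ * φ⁻¹ + 1 - φ⁻¹) * h1
  calc ((s.powerset.filter fun t => s.card + t.card ≤ m).card : ℝ)
      = ∑ t ∈ s.powerset.filter fun t => s.card + t.card ≤ m, (1 : ℝ) := by simp
    -- Each counted `t` has weight `φ ^ (m - #s - #t) ≥ 1`. Extended to all subsets, the sum factors
    -- by the binomial theorem and collapses through `hz`.
    _ ≤ ∑ t ∈ s.powerset.filter fun t => s.card + t.card ≤ m,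
          φ ^ m * (φ⁻¹ ^ s.card * φ⁻¹ ^ t.card) := by
        refine Finset.sum_le_sum fun t ht => ?_
        rw [← pow_add, inv_pow, ← div_eq_mul_inv, one_le_div (by positivity)]
        exact pow_le_pow_right₀ Real.one_lt_goldenRatio.le (Finset.mem_filter.1 ht).2
    _ ≤ ∑ t ∈ s.powerset, φ ^ m * (φ⁻¹ ^ s.card * φ⁻¹ ^ t.card) :=
        Finset.sum_le_sum_of_subset_of_nonneg (Finset.filter_subset _ _)
          fun _ _ _ => by positivity
    _ = φ ^ m * (φ⁻¹ * (φ⁻¹ + 1)) ^ s.card := by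
        rw [← Finset.mul_sum, ← Finset.mul_sum, mul_pow, ← Finset.sum_pow_mul_eq_add_pow]
        simp
    _ = φ ^ m := by rw [hz, one_pow, mul_one]

/-! ### Upper bound for the generators `a`, `t` -/

namespace Lamplighter

variable {n : ℕ}

theorem support_lamp_mul_subset (g x : Lamplighter n) (hx : ∀ i ≠ 0, lamp x i = 0) :
    (lamp (g * x)).support ⊆ insert (pos g) (lamp g).support := by
  intro i hi
  rw [Finset.mem_insert, Finsupp.mem_support_iff]
  rw [Finsupp.mem_support_iff, lamp_mul_apply] at hi
  by_contra! h
  exact hi (by rw [h.2, hx _ (sub_ne_zero.2 h.1), add_zero])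

/-- A word in `a` and `t` only visits the positions in some interval, and its length is at least
the length of this interval plus the number of lit lamps. -/
theorem exists_interval_of_word (l : List (Lamplighter n))
    (hl : ∀ x ∈ l, x ∈ ({a n, t n} : Set (Lamplighter n)) ∨
      x⁻¹ ∈ ({a n, t n} : Set (Lamplighter n))) :
    ∃ u v : ℤ, u ≤ 0 ∧ 0 ≤ v ∧ u ≤ pos l.prod ∧ pos l.prod ≤ v ∧
      (lamp l.prod).support ⊆ Finset.Icc u v ∧
      v - u + (lamp l.prod).support.card ≤ l.length := by
  induction l using List.reverseRecOn with
  | nil => exact ⟨0, 0, by simp⟩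
  | append_singleton l x ih =>
    obtain ⟨u, v, hu, hv, hup, hpv, hs, hc⟩ := ih fun x hx => hl x (by simp [hx])
    rw [List.prod_append, List.prod_singleton, List.length_append, List.length_singleton]
    set g := l.prod
    have hx : (pos x = 0 ∧ ∀ i ≠ 0, lamp x i = 0) ∨ ((pos x = 1 ∨ pos x = -1) ∧ lamp x = 0) := by
      have hinv : ∀ {y : Lamplighter n}, x⁻¹ = y → x = y⁻¹ := fun h => by rw [← h, inv_inv]
      rcases hl x (by simp) with (h | h) | (h | h)
      · rw [h]
        exact Or.inl ⟨rfl, fun i hi => by simp [hi.symm]⟩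
      · rw [h]
        exact Or.inr ⟨Or.inl rfl, rfl⟩
      · rw [hinv h]
        exact Or.inl ⟨by simp, fun i hi => by simp [hi.symm]⟩
      · rw [hinv h]
        exact Or.inr ⟨Or.inr (by simp), by ext i; simp⟩
    -- A letter `a` or its inverse adds at most one lit lamp, at the current position; a letter `t`
    -- or its inverse lengthens the interval by at most one.
    rcases hx with ⟨hx0, hx⟩ | ⟨hx0, hx⟩
    · have hsub := support_lamp_mul_subset g x hx
      have hcard := (Finset.card_le_card hsub).trans (Finset.card_insert_le _ _)
      refine ⟨u, v, hu, hv, by simpa [hx0], by simpa [hx0], hsub.trans ?_, by push_cast; omega⟩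
      exact Finset.insert_subset (Finset.mem_Icc.2 ⟨hup, hpv⟩) hs
    · have hlamp : lamp (g * x) = lamp g := by ext i; simp [hx]
      rw [hlamp, pos_mul]
      refine ⟨min u (pos g + pos x), max v (pos g + pos x), by omega, by omega, by omega, by omega,
        hs.trans (Finset.Icc_subset_Icc (by omega) (by omega)), by push_cast; omega⟩

/-- The three polynomial factors count the final position and the two ends of the interval. The
exponent is `m + 1` because an interval from u to v has v - u + 1 points. -/
theorem growthFunction_a_t_le (m : ℕ) :
    (growthFunction {a 2, t 2} m : ℝ) ≤ (2 * m + 1) ^ 3 * φ ^ (m + 1) := by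
  classical
  set I : Finset ℤ := Finset.Icc (-m : ℤ) m with hI
  have hIcard : I.card = 2 * m + 1 := by
    rw [hI, Int.card_Icc]; omega
  set T : ℤ × ℤ → Finset (Finset ℤ) := fun p =>
    (Finset.Icc p.1 p.2).powerset.filter fun s => (Finset.Icc p.1 p.2).card + s.card ≤ m + 1
    with hT
  set W : Finset (ℤ × Finset ℤ) := I ×ˢ (I ×ˢ I).biUnion T with hW
  have hmem : ∀ g : {g : Lamplighter 2 // wordLength {a 2, t 2} g ≤ m},
      (pos g.1, (lamp g.1).support) ∈ W := by
    rintro ⟨g, hg⟩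
    obtain ⟨l, hl, rfl, hlen⟩ := (wordLength_le_iff _ g m).1 hg
    obtain ⟨u, v, hu, hv, hup, hpv, hs, hc⟩ := exists_interval_of_word l hl
    change (pos l.prod, (lamp l.prod).support) ∈ W
    refine Finset.mem_product.2 ⟨Finset.mem_Icc.2 ⟨by omega, by omega⟩,
      Finset.mem_biUnion.2 ⟨(u, v), Finset.mem_product.2 ⟨Finset.mem_Icc.2 ⟨by omega, by omega⟩,
        Finset.mem_Icc.2 ⟨by omega, by omega⟩⟩, Finset.mem_filter.2
        ⟨Finset.mem_powerset.2 hs, ?_⟩⟩⟩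
    dsimp only
    rw [Int.card_Icc]
    omega
  have hcard : growthFunction {a 2, t 2} m ≤ W.card := by
    rw [← Nat.card_eq_finsetCard]
    refine Nat.card_le_card_of_injective (fun g => (⟨_, hmem g⟩ : W)) fun g h hgh => ?_
    obtain ⟨hp, hs⟩ := Prod.ext_iff.1 (congrArg Subtype.val hgh)
    refine Subtype.ext (ext_lamp_pos (fun i => ?_) hp)
    -- With two lamp states, the support determines the configuration.
    have hbin : ∀ c d : ZMod 2, (c ≠ 0 ↔ d ≠ 0) → c = d := by decide
    refine hbin _ _ ?_
    rw [← Finsupp.mem_support_iff, ← Finsupp.mem_support_iff]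
    exact iff_of_eq (congrArg (i ∈ ·) hs)
  have hT' : (((I ×ˢ I).biUnion T).card : ℝ) ≤ (2 * m + 1) ^ 2 * φ ^ (m + 1) := by
    calc (((I ×ˢ I).biUnion T).card : ℝ) ≤ ∑ p ∈ I ×ˢ I, ((T p).card : ℝ) := by
          exact_mod_cast Finset.card_biUnion_le
      _ ≤ ∑ p ∈ I ×ˢ I, φ ^ (m + 1) :=
          Finset.sum_le_sum fun p _ => card_filter_powerset_le _ _
      _ = (2 * m + 1) ^ 2 * φ ^ (m + 1) := by
          rw [Finset.sum_const, Finset.card_product, hIcard, nsmul_eq_mul]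
          push_cast
          ring
  calc (growthFunction {a 2, t 2} m : ℝ) ≤ W.card := by exact_mod_cast hcard
    _ = (2 * m + 1) * (((I ×ˢ I).biUnion T).card : ℝ) := by
        rw [hW, Finset.card_product, hIcard]
        push_cast
        ring
    _ ≤ (2 * m + 1) * ((2 * m + 1) ^ 2 * φ ^ (m + 1)) := by gcongr
    _ = _ := by ring

theorem growthRate_a_t_le : growthRate {a 2, t 2} ≤ φ := by
  have h0 := Real.goldenRatio_pos
  refine growthRate_le_of_le (by simp) (c := 27 * φ) 3 (by positivity) h0 fun m hm => ?_
  refine (growthFunction_a_t_le m).trans ?_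
  have h1 : (1 : ℝ) ≤ m := by exact_mod_cast Nat.one_le_iff_ne_zero.2 hm
  calc (2 * (m : ℝ) + 1) ^ 3 * φ ^ (m + 1) ≤ (3 * m) ^ 3 * φ ^ (m + 1) := by
        gcongr
        linarith
    _ = _ := by ring

end Lamplighter

end GoldenRatio

/-! ### Ascending HNN extensions -/

section AscendingHNN

/-- The isomorphism from a group onto the image of an injective endomorphism. -/
noncomputable def ascendingEquiv {H : Type*} [Group H] (f : H →* H)
    (hf : Function.Injective f) : (⊤ : Subgroup H) ≃* f.range :=
  Subgroup.topEquiv.trans (MonoidHom.ofInjective hf)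

namespace HNNExtension

variable {H : Type*} [Group H] {f : H →* H} {hf : Function.Injective f}

theorem ascending_t_mul_of (k : H) :
    (t * of k : HNNExtension H ⊤ f.range (ascendingEquiv f hf)) = of (f k) * t :=
  t_mul_of (φ := ascendingEquiv f hf) ⟨k, Subgroup.mem_top k⟩

theorem ascending_t_pow_mul_of (m : ℕ) (k : H) : ∃ k' : H,
    (t ^ m * of k : HNNExtension H ⊤ f.range (ascendingEquiv f hf)) = of k' * t ^ m := by
  induction m with
  | zero => exact ⟨k, by simp⟩
  | succ m ih =>
    obtain ⟨k', h⟩ := ih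
    exact ⟨f k', by rw [pow_succ', mul_assoc, h, ← mul_assoc, ascending_t_mul_of, mul_assoc]⟩

/-- Every element of an ascending HNN extension has the form `t⁻ⁱ k tʲ`. -/
theorem ascending_exists_eq (g : HNNExtension H ⊤ f.range (ascendingEquiv f hf)) :
    ∃ (i j : ℕ) (k : H), g = (t ^ i)⁻¹ * of k * t ^ j := by
  induction g using HNNExtension.induction_on with
  | of k => exact ⟨0, 0, k, by simp⟩
  | t => exact ⟨0, 1, 1, by simp⟩
  | mul x y hx hy =>
    obtain ⟨i, j, k, rfl⟩ := hx
    obtain ⟨i', j', k', rfl⟩ := hy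
    -- The middle powers of `t` cancel. A leftover positive power moves right past `of k'`, a
    -- leftover negative one moves left past `of k`.
    rcases le_total i' j with h | h
    · obtain ⟨m, rfl⟩ := Nat.exists_eq_add_of_le' h
      obtain ⟨c, hc⟩ := ascending_t_pow_mul_of (f := f) (hf := hf) m k'
      refine ⟨i, m + j', k * c, ?_⟩
      calc (t ^ i)⁻¹ * of k * t ^ (m + i') * ((t ^ i')⁻¹ * of k' * t ^ j')
          = (t ^ i)⁻¹ * of k * (t ^ m * of k') * t ^ j' := by rw [pow_add]; group
        _ = _ := by rw [hc, map_mul, pow_add]; group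
    · obtain ⟨m, rfl⟩ := Nat.exists_eq_add_of_le' h
      obtain ⟨c, hc⟩ := ascending_t_pow_mul_of (f := f) (hf := hf) m k
      refine ⟨m + i, j', c * k', ?_⟩
      have hc' : (of k * (t ^ m)⁻¹ : HNNExtension H ⊤ f.range (ascendingEquiv f hf)) =
          (t ^ m)⁻¹ * of c := by
        rw [mul_inv_eq_iff_eq_mul, mul_assoc, ← hc, inv_mul_cancel_left]
      calc (t ^ i)⁻¹ * of k * t ^ j * ((t ^ (m + j))⁻¹ * of k' * t ^ j')
          = (t ^ i)⁻¹ * (of k * (t ^ m)⁻¹) * of k' * t ^ j' := by rw [pow_add]; group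
        _ = _ := by rw [hc', map_mul, pow_add]; group
  | inv x hx =>
    obtain ⟨i, j, k, rfl⟩ := hx
    exact ⟨j, i, k⁻¹, by rw [map_inv]; group⟩

end HNNExtension

/-- A criterion for `G` to be an ascending HNN extension of a subgroup `K` with stable letter
`s`. -/
theorem isNonSemidirectHNN_of_ascending {G : Type*} [Group G] (K : Subgroup G) (s : G)
    (hconj : ∀ k ∈ K, s * k * s⁻¹ ∈ K) (hproper : ∃ k ∈ K, s⁻¹ * k * s ∉ K)
    (hpow : ∀ i j : ℕ, (s ^ i)⁻¹ * s ^ j ∈ K → i = j)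
    (hgen : Subgroup.closure (insert s (K : Set G)) = ⊤) : IsNonSemidirectHNN G := by
  let f : K →* K :=
    { toFun := fun k => ⟨s * k * s⁻¹, hconj k k.2⟩
      map_one' := by ext; simp
      map_mul' := fun x y => by ext; simp }
  have hf : Function.Injective f := fun x y h => by
    have : s * x * s⁻¹ = s * y * s⁻¹ := congrArg Subtype.val h
    exact Subtype.ext (by simpa using this)
  refine ⟨K, inferInstance, ⊤, f.range, ascendingEquiv f hf, Or.inr fun h => ?_, ?_⟩
  · obtain ⟨k, hk, hk'⟩ := hproper
    obtain ⟨k₀, hk₀⟩ : (⟨k, hk⟩ : K) ∈ f.range := h ▸ Subgroup.mem_top _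
    refine hk' ?_
    have : s * k₀ * s⁻¹ = k := congrArg Subtype.val hk₀
    rw [← this]
    simp [mul_assoc]
  · let F : HNNExtension K ⊤ f.range (ascendingEquiv f hf) →* G :=
      HNNExtension.lift K.subtype s fun k => by
        change s * (k : G) = s * (k : G) * s⁻¹ * s
        simp
    have hFt : F HNNExtension.t = s := HNNExtension.lift_t _ _ _
    have hFof : ∀ k : K, F (HNNExtension.of k) = k := HNNExtension.lift_of _ _ _
    refine ⟨(MulEquiv.ofBijective F ⟨?_, ?_⟩).symm⟩
    -- A kernel element in the form `t⁻ⁱ k tʲ` makes `k` a power of `s` lying in `K`; `hpow` then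
    -- forces `i = j`, hence `k = 1`.
    · refine (injective_iff_map_eq_one F).2 fun g hg => ?_
      obtain ⟨i, j, k, rfl⟩ := HNNExtension.ascending_exists_eq g
      simp only [map_mul, map_inv, map_pow, hFt, hFof] at hg
      have hk : (k : G) = s ^ i * (s ^ j)⁻¹ := by
        rw [mul_assoc, inv_mul_eq_one, ← mul_inv_eq_iff_eq_mul] at hg
        exact hg.symm
      have hij : i = j := hpow i j (by
        have : (s ^ i)⁻¹ * s ^ j = ((k : G))⁻¹ := by
          rw [hk, mul_inv_rev, inv_inv]
          exact ((Commute.refl s).pow_pow i j).inv_left.eq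
        rw [this]
        exact inv_mem k.2)
      subst hij
      have : k = 1 := Subtype.ext (by rw [hk]; simp)
      rw [this]
      simp
    · rw [← MonoidHom.range_eq_top, eq_top_iff, ← hgen, Subgroup.closure_le]
      rintro x (rfl | hx)
      · exact ⟨_, hFt⟩
      · exact ⟨_, hFof ⟨x, hx⟩⟩

end AscendingHNN

/-! ### HNN structure of the lamplighter group and conclusion -/

namespace Lamplighter

variable {n : ℕ}

/-- The subgroup of lamp configurations supported on the nonnegative positions. -/
def nonnegLamps (n : ℕ) : Subgroup (Lamplighter n) where
  carrier := {g | pos g = 0 ∧ ∀ i < 0, lamp g i = 0}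
  one_mem' := ⟨rfl, fun _ _ => rfl⟩
  mul_mem' := fun {g h} hg hh =>
    ⟨by simp [hg.1, hh.1], fun i hi => by simp [hg.1, hg.2 i hi, hh.2 i hi]⟩
  inv_mem' := fun {g} hg => ⟨by simp [hg.1], fun i hi => by simp [hg.1, hg.2 i hi]⟩

/-- Conjugation by `t` shifts lamps one step right. It is not onto `nonnegLamps n`, since shifting
`a` back lights position -1; a power of `t` in `nonnegLamps n` is trivial because `pos` vanishes
there. -/
theorem isNonSemidirectHNN [Fact (1 < n)] : IsNonSemidirectHNN (Lamplighter n) := by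
  have ha : a n ∈ nonnegLamps n := ⟨rfl, fun i hi => by simp [hi.ne']⟩
  refine isNonSemidirectHNN_of_ascending (nonnegLamps n) (t n) (fun k hk => ⟨?_, fun i hi => ?_⟩)
    ⟨a n, ha, fun h => ?_⟩ (fun i j h => ?_) (eq_top_iff.2 ?_)
  · simp [hk.1]
  · simp [hk.2 (i - 1) (by omega)]
  · simpa [Finsupp.single_apply] using h.2 (-1) (by norm_num)
  · have := h.1
    rw [← zpow_natCast, ← zpow_natCast] at this
    simp only [pos_mul, pos_inv, pos_zpow, pos_t] at this
    omega
  · rw [← closure_a_t]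
    refine Subgroup.closure_mono ?_
    rintro x (rfl | rfl)
    exacts [Or.inr ha, Or.inl rfl]

instance : Group.FG (Lamplighter n) :=
  ⟨⟨{a n, t n}, by simpa using closure_a_t⟩⟩

theorem isLeast_growthRate_a_t :
    IsLeast {r : ℝ | ∃ S : Set (Lamplighter 2), S.Finite ∧ Subgroup.closure S = ⊤ ∧
      growthRate S = r} (growthRate {a 2, t 2}) :=
  ⟨⟨_, by simp, closure_a_t, rfl⟩, by
    rintro _ ⟨S, hS, hgen, rfl⟩
    exact growthRate_a_t_le.trans (goldenRatio_le_growthRate hS hgen)⟩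

end Lamplighter

theorem proposition8 :
    Subgroup.closure {Lamplighter.a 2, Lamplighter.t 2} = ⊤ ∧
    growthRate {Lamplighter.a 2, Lamplighter.t 2} = minimalGrowthRate (Lamplighter 2) ∧
    minimalGrowthRate (Lamplighter 2) = (1 + Real.sqrt 5) / 2 ∧
    IsNonSemidirectHNN (Lamplighter 2) ∧
    (∀ c : ℝ, (∀ (G : Type) [Group G] [Group.FG G], IsNonSemidirectHNN G →
      c ≤ minimalGrowthRate G) → c ≤ (1 + Real.sqrt 5) / 2) := by
  have hmin : minimalGrowthRate (Lamplighter 2) = growthRate {Lamplighter.a 2, Lamplighter.t 2} :=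
    Lamplighter.isLeast_growthRate_a_t.csInf_eq
  have hval : minimalGrowthRate (Lamplighter 2) = (1 + Real.sqrt 5) / 2 :=
    hmin.trans (le_antisymm Lamplighter.growthRate_a_t_le
      (Lamplighter.goldenRatio_le_growthRate (by simp) Lamplighter.closure_a_t))
  exact ⟨Lamplighter.closure_a_t, hmin.symm, hval, Lamplighter.isNonSemidirectHNN,
    fun c hc => hval ▸ hc (Lamplighter 2) Lamplighter.isNonSemidirectHNN⟩
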